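/- Let $T$ be a tree on $n\ge 1$ vertices labelled $1,\dots,n$, rooted at one of its vertices, with all edges directed away from the root. In \emph{comply-constrain Slither}, a token moves along directed edges; the player about to move proposes two different children of the current vertex and the opponent decides to which of the two the token is moved. A player who cannot propose two different moves loses. A vertex is a \emph{$P$-position} if the player who just moved to it wins, and an \emph{$N$-position} if the player about to move from it wins; equivalently, a vertex is a $P$-position if and only if at most one of its children is a $P$-position. The \emph{comply-constrain slither code} $(s_1,\dots,s_{n-1})$ of $T$ is obtained as follows. Start with $n-1$ empty slots. Repeatedly remove from the tree the leaf (childless vertex) with the smallest label and put it in the leftmost empty slot if it is a $P$-position of the original tree $T$, and in the rightmost empty slot if it is an $N$-position of $T$, until only the root remains. If $(a_1,\dots,a_{n-1})$ is the resulting sequence, let $s_i$ be the parent of $a_i$ in $T$. Let $\beta\ge 0$ be the smallest number such that the prefix $(s_1,\dots,s_\beta)$ contains at least $n-1-\beta$ distinct numbers that each occur at least twice in the prefix, and let $k$ be the number of symbols that remain in $(s_1,\dots,s_\beta)$ after discarding the third and all later occurrences of each number. Then $k$ is the maximum number of edges in a path-collection in $T$, that is, in a set of edges of $T$ of which no more than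 two meet at any vertex. Consequently $n-k$ is the path cover number of $T$, that is, the minimum number of vertex-disjoint paths in $T$ (single vertices allowed) that together cover all vertices. -/

import Mathlib

/-- A tree on the vertices `Fin n` (the labels, with their usual order), rooted at one of them. -/
structure LabelledRootedTree (n : ℕ) where
  graph : SimpleGraph (Fin n)
  isTree : graph.IsTree
  root : Fin n

namespace LabelledRootedTree

variable {n : ℕ}

/-- The unique path in the tree from a vertex to the root. -/
noncomputable def pathToRoot (T : LabelledRootedTree n) (v : Fin n) : T.graph.Walk v T.root :=
  (T.isTree.existsUnique_path v T.root).choose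

/-- The parent of a non-root vertex `v`: the vertex after `v` on the path from `v` to the root.
(The value at the root itself is not used.) -/
noncomputable def parent (T : LabelledRootedTree n) (v : Fin n) : Fin n :=
  (T.pathToRoot v).snd

/-- `T.IsChild p c`: there is an edge from `p` to `c`, directed away from the root. -/
def IsChild (T : LabelledRootedTree n) (p c : Fin n) : Prop :=
  c ≠ T.root ∧ T.parent c = p

/- Comply-constrain Slither: the player about to move (from the vertex holding the token) proposes
two different children of that vertex, and the opponent decides which of these two moves is played.
A player who cannot propose two different moves loses. -/
mutual

/-- `N`-positions: the player about to move wins, by proposing two moves such that, whichever of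
them the opponent selects, the vertex moved to is a win for the player who just moved. -/
inductive IsN (T : LabelledRootedTree n) : Fin n → Prop
  | intro {v a b : Fin n} : T.IsChild v a → T.IsChild v b → a ≠ b →
      IsP T a → IsP T b → IsN T v

/-- `P`-positions: the player who just moved wins, by a selection rule `sel` that picks from every
two moves `a`, `b` that the player about to move may propose one that is losing for its proposer. -/
inductive IsP (T : LabelledRootedTree n) : Fin n → Prop
  | intro {v : Fin n} (sel : Fin n → Fin n → Fin n) :
      (∀ a b : Fin n, sel a b = a ∨ sel a b = b) →
      (∀ a b : Fin n, T.IsChild v a → T.IsChild v b → a ≠ b → IsN T (sel a b)) → IsP T v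

end

open Classical in
/-- The leafs (childless vertices), other than the root of `T`, of the tree that is left when
exactly the vertices in `R` remain. -/
noncomputable def leafs (T : LabelledRootedTree n) (R : Finset (Fin n)) : Finset (Fin n) :=
  R.filter fun v => v ≠ T.root ∧ ∀ c ∈ R, ¬ T.IsChild v c

theorem erase_min_leafs_card_lt (T : LabelledRootedTree n) (R : Finset (Fin n))
    (h : (T.leafs R).Nonempty) : (R.erase ((T.leafs R).min' h)).card < R.card := by
  have hm := (T.leafs R).min'_mem h
  simp only [leafs, Finset.mem_filter] at hm
  exact Finset.card_erase_lt_of_mem hm.1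

open Classical in
/-- The contents, from left to right, of the slots of the auxiliary sequence that are filled from
the moment when exactly the vertices in `R` remain. The leaf with the smallest label is removed.
It goes to the leftmost of these slots if it is a `P`-position (of the original tree), and to the
rightmost of them otherwise; the slots in between are filled by continuing with the smaller tree,
until only the root is left. -/
noncomputable def auxFrom (T : LabelledRootedTree n) (R : Finset (Fin n)) : List (Fin n) :=
  if h : (T.leafs R).Nonempty then
    if T.IsP ((T.leafs R).min' h) then
      (T.leafs R).min' h :: auxFrom T (R.erase ((T.leafs R).min' h))
    else
      auxFrom T (R.erase ((T.leafs R).min' h)) ++ [(T.leafs R).min' h]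
  else []
termination_by R.card
decreasing_by all_goals exact erase_min_leafs_card_lt T R h

/-- The auxiliary sequence `(a₁, …, aₙ₋₁)`, a permutation of the vertices other than the root. -/
noncomputable def auxSeq (T : LabelledRootedTree n) : List (Fin n) :=
  T.auxFrom Finset.univ

/-- The comply-constrain slither code `(s₁, …, sₙ₋₁)`, where `sᵢ` is the parent of `aᵢ`. -/
noncomputable def slitherCode (T : LabelledRootedTree n) : List (Fin n) :=
  T.auxSeq.map T.parent

/-- A path-collection: a set of edges of which no more than two meet at any vertex. -/
def IsPathCollection (T : LabelledRootedTree n) (S : Finset (Sym2 (Fin n))) : Prop :=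
  (∀ e ∈ S, e ∈ T.graph.edgeSet) ∧ ∀ v : Fin n, (S.filter fun e => v ∈ e).card ≤ 2

/-- A path cover: a partition of the vertices into the vertex sets of paths of the tree
(a single vertex counts as a path). -/
def IsPathCover (T : LabelledRootedTree n) (C : Finpartition (Finset.univ : Finset (Fin n))) : Prop :=
  ∀ B ∈ C.parts, ∃ (u v : Fin n) (p : T.graph.Walk u v), p.IsPath ∧ p.support.toFinset = B

end LabelledRootedTree

/-- The set of symbols that occur at least twice in `l` (the distinct doublets of `l`). -/
def doublets {n : ℕ} (l : List (Fin n)) : Finset (Fin n) :=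
  Finset.univ.filter fun x => 2 ≤ l.count x

/-- Given that the symbols in `seen` have been read before, go through a list and discard each
symbol that already has occurred twice. -/
def keepFirstTwoAfter {n : ℕ} (seen : List (Fin n)) : List (Fin n) → List (Fin n)
  | [] => []
  | x :: l =>
    if seen.count x < 2 then x :: keepFirstTwoAfter (x :: seen) l
    else keepFirstTwoAfter (x :: seen) l

/-- What remains of `l` if the third and following occurrences of each symbol are discarded. -/
def keepFirstTwo {n : ℕ} (l : List (Fin n)) : List (Fin n) :=
  keepFirstTwoAfter [] l

-- All three quantities come down to `maxEdges`, the sum over all vertices of the number of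
-- `P`-children capped at two. No path-collection is larger: an edge into an `N`-position from a
-- `P`-position is charged to its child, every other edge to its parent. An `N`-position then pays
-- for at most two edges, a `P`-position only for edges to its `P`-children, of which there is at
-- most one. Equality holds when every vertex takes as many edges to `P`-children as the cap allows,
-- since then no `N`-position is joined to its parent.
--
-- In the code, the symbols contributed by `P`-positions come first and contain each vertex once per
-- `P`-child, so their doublets are exactly the `N`-positions and the capped length is `maxEdges`
-- (`exists_auxFrom_eq_append`, `count_map_parent`). The position `β` is the end of this block or,
-- if the root is an `N`-position, possibly one symbol earlier; the skipped symbol would then be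
-- discarded anyway.
--
-- A path cover with `m` parts has `n - m` edges, and the components of a path-collection are paths,
-- which gives the path cover number.

-- Edges of a path at a given vertex; graphs of maximum degree two.

namespace SimpleGraph.Walk

variable {V : Type*} [DecidableEq V] {G : SimpleGraph V}

theorem IsPath.countP_start_mem_edges_le {u v : V} {p : G.Walk u v} (hp : p.IsPath) :
    p.edges.countP (fun e => u ∈ e) ≤ 1 := by
  cases p with
  | nil => simp
  | @cons _ w _ h q =>
    rw [cons_isPath_iff] at hp
    have h0 : q.edges.countP (fun e => u ∈ e) = 0 := by
      rw [List.countP_eq_zero]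
      intro e he hu
      exact hp.2 (q.mem_support_of_mem_edges he (by simpa using hu))
    simp [h0]

theorem IsPath.countP_mem_edges_le {u v : V} {p : G.Walk u v} (hp : p.IsPath) (x : V) :
    p.edges.countP (fun e => x ∈ e) ≤ 2 := by
  induction p with
  | nil => simp
  | @cons u w _ h q ih =>
    have hq := hp.of_cons
    by_cases hu : x = u
    · subst hu
      exact hp.countP_start_mem_edges_le.trans one_le_two
    · by_cases hw : x = w
      · subst hw
        have := hq.countP_start_mem_edges_le
        simp only [edges_cons, List.countP_cons]
        split_ifs <;> omega
      · simpa [List.countP_cons, hu, hw] using ih hq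

theorem IsPath.two_le_countP_mem_edges {u v : V} {p : G.Walk u v} (hp : p.IsPath) {x : V}
    (hx : x ∈ p.support) (hu : x ≠ u) (hv : x ≠ v) :
    2 ≤ p.edges.countP (fun e => x ∈ e) := by
  induction p with
  | nil => simp_all
  | @cons u w _ h q ih =>
    have hq := hp.of_cons
    have hx' : x ∈ q.support := by simpa [hu] using hx
    by_cases hw : x = w
    · subst hw
      cases q with
      | nil => exact absurd rfl hv
      | cons h' r => simp
    · have := ih hq hx' hw hv
      simp only [edges_cons, List.countP_cons]
      omega

end SimpleGraph.Walk

namespace SimpleGraph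

variable {V : Type*} [Fintype V] [DecidableEq V] {G : SimpleGraph V}

/-- In a finite graph of maximum degree at most two, a longest path through a component visits
every vertex of the component. -/
theorem exists_isPath_support_eq_of_card_incidence_le_two {S : Finset (Sym2 V)}
    (hS : ∀ e, e ∈ S ↔ e ∈ G.edgeSet) (hdeg : ∀ v, (S.filter fun e => v ∈ e).card ≤ 2) (a : V) :
    ∃ (u v : V) (p : G.Walk u v), p.IsPath ∧ ∀ x, x ∈ p.support ↔ G.Reachable a x := by
  classical
  let Q : ℕ → Prop := fun m => ∃ (u v : V) (p : G.Walk u v),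
    p.IsPath ∧ p.length = m ∧ G.Reachable a u
  have hQ0 : Q 0 := ⟨a, a, .nil, .nil, rfl, .rfl⟩
  have hbound : ∀ m, Q m → m ≤ Fintype.card V := by
    rintro m ⟨u, v, p, hp, rfl, -⟩
    exact hp.length_lt.le
  obtain ⟨u, v, p, hp, hlen, hau⟩ := Nat.findGreatest_spec (P := Q) (Nat.zero_le _) hQ0
  have hmax : ∀ {u' v' : V} (q : G.Walk u' v'), q.IsPath → G.Reachable a u' →
      q.length ≤ p.length := fun q hq hr => by
    rw [hlen]
    exact Nat.le_findGreatest (hbound _ ⟨_, _, q, hq, rfl, hr⟩) ⟨_, _, q, hq, rfl, hr⟩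
  -- A neighbour off the path would prolong it at an end vertex, or give an inner vertex a third
  -- edge.
  have hclosed : ∀ x ∈ p.support, ∀ w, G.Adj x w → w ∈ p.support := by
    intro x hx w hxw
    by_contra hw
    by_cases hxu : x = u
    · subst hxu
      have := hmax (.cons hxw.symm p) (hp.cons hw) (hau.trans hxw.reachable)
      simp at this
    by_cases hxv : x = v
    · subst hxv
      have := hmax (.cons hxw.symm p.reverse) (hp.reverse.cons (by simpa using hw))
        ((hau.trans p.reachable).trans hxw.reachable)
      simp at this
    have h2 := hp.two_le_countP_mem_edges hx hxu hxv
    have hsub : insert s(x, w) ((p.edges.filter fun e => x ∈ e).toFinset) ⊆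
        S.filter fun e => x ∈ e := by
      intro e he
      rw [Finset.mem_insert] at he
      rcases he with rfl | he
      · simpa [hS] using hxw
      · simp only [List.mem_toFinset, List.mem_filter, decide_eq_true_eq] at he
        rw [Finset.mem_filter, hS]
        exact ⟨p.edges_subset_edgeSet he.1, he.2⟩
    have hnot : s(x, w) ∉ (p.edges.filter fun e => x ∈ e).toFinset := by
      intro he
      simp only [List.mem_toFinset, List.mem_filter] at he
      exact hw (p.snd_mem_support_of_mem_edges he.1)
    have := (Finset.card_le_card hsub).trans (hdeg x)
    rw [Finset.card_insert_of_notMem hnot,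
      List.toFinset_card_of_nodup (hp.isTrail.edges_nodup.filter _),
      ← List.countP_eq_length_filter] at this
    omega
  refine ⟨u, v, p, hp, fun x => ⟨fun hx => hau.trans (p.takeUntil x hx).reachable, fun hx => ?_⟩⟩
  obtain ⟨q⟩ := hau.symm.trans hx
  have key : ∀ {y z : V} (q : G.Walk y z), y ∈ p.support → z ∈ p.support := by
    intro y z q
    induction q with
    | nil => exact id
    | cons h _ ih => exact fun hy => ih (hclosed _ hy _ h)
  exact key q p.start_mem_support

end SimpleGraph

-- Counting the symbols that are kept.

section KeepFirstTwo

variable {n : ℕ}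

/-- The sum over `seen` counts what has been kept already; reading `y` raises it by one exactly when
`y` is kept. -/
theorem length_keepFirstTwoAfter (l seen : List (Fin n)) :
    (keepFirstTwoAfter seen l).length + ∑ x, min 2 (seen.count x) =
      ∑ x, min 2 (seen.count x + l.count x) := by
  induction l generalizing seen with
  | nil => simp [keepFirstTwoAfter]
  | cons y l ih =>
    have h := ih (y :: seen)
    have h1 : ∑ x, min 2 ((y :: seen).count x + l.count x) =
        ∑ x, min 2 (seen.count x + (y :: l).count x) := by
      refine Finset.sum_congr rfl fun x _ => ?_
      simp only [List.count_cons]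
      congr 1
      omega
    have h2 : ∑ x, min 2 ((y :: seen).count x) =
        (∑ x, min 2 (seen.count x)) + if seen.count y < 2 then 1 else 0 := by
      have : ∀ x, min 2 ((y :: seen).count x) =
          min 2 (seen.count x) + if x = y then (if seen.count y < 2 then 1 else 0) else 0 := by
        intro x
        by_cases hx : x = y
        · subst hx
          simp only [List.count_cons_self, if_true]
          split_ifs <;> omega
        · simp [hx, Ne.symm hx]
      simp_rw [this, Finset.sum_add_distrib]
      simp
    rw [h1, h2] at h
    rw [keepFirstTwoAfter]
    split_ifs with hc
    · rw [if_pos hc] at h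
      rw [List.length_cons]
      omega
    · rw [if_neg hc] at h
      omega

theorem length_keepFirstTwo (l : List (Fin n)) :
    (keepFirstTwo l).length = ∑ x, min 2 (l.count x) := by
  simpa [keepFirstTwo] using length_keepFirstTwoAfter l []

end KeepFirstTwo

-- Parents, depth and edges.

namespace LabelledRootedTree

variable {n : ℕ} (T : LabelledRootedTree n)

theorem pathToRoot_isPath (v : Fin n) : (T.pathToRoot v).IsPath :=
  (T.isTree.existsUnique_path v T.root).choose_spec.1

theorem pathToRoot_eq {v : Fin n} (p : T.graph.Walk v T.root) (hp : p.IsPath) :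
    T.pathToRoot v = p :=
  (T.isTree.existsUnique_path v T.root).unique (T.pathToRoot_isPath v) hp

/-- The number of edges on the path from a vertex to the root. -/
noncomputable def depth (v : Fin n) : ℕ := (T.pathToRoot v).length

theorem depth_lt (v : Fin n) : T.depth v < n := by
  simpa [depth] using (T.pathToRoot_isPath v).length_lt

variable {T}

theorem not_nil_pathToRoot {v : Fin n} (hv : v ≠ T.root) : ¬ (T.pathToRoot v).Nil :=
  SimpleGraph.Walk.not_nil_of_ne hv

theorem adj_parent {v : Fin n} (hv : v ≠ T.root) : T.graph.Adj v (T.parent v) :=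
  SimpleGraph.Walk.adj_snd (not_nil_pathToRoot hv)

theorem depth_parent {v : Fin n} (hv : v ≠ T.root) : T.depth (T.parent v) + 1 = T.depth v := by
  unfold depth
  rw [T.pathToRoot_eq (v := T.parent v) (T.pathToRoot v).tail (T.pathToRoot_isPath v).tail]
  exact SimpleGraph.Walk.length_tail_add_one (not_nil_pathToRoot hv)

/-- If `u` lies on the path from `v` to the root, that path must begin with the edge to `u`, by
uniqueness; otherwise prepending `u` to it gives the path from `u`. -/
theorem parent_of_adj {u v : Fin n} (h : T.graph.Adj u v) :
    (u ≠ T.root ∧ T.parent u = v) ∨ (v ≠ T.root ∧ T.parent v = u) := by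
  classical
  by_cases hu : u ∈ (T.pathToRoot v).support
  · right
    have hd := (T.pathToRoot_isPath v).dropUntil hu
    have hv : v ∉ ((T.pathToRoot v).dropUntil u hu).support := by
      intro hv
      have hnd := (T.pathToRoot_isPath v).support_nodup
      rw [← (T.pathToRoot v).take_spec hu, SimpleGraph.Walk.support_append_eq_support_dropLast_append] at hnd
      rw [List.nodup_append] at hnd
      refine hnd.2.2 v ?_ v hv rfl
      cases hq : (T.pathToRoot v).takeUntil u hu with
      | nil => exact absurd h (T.graph.loopless.irrefl _)
      | cons h' q => cases q <;> simp
    have heq := T.pathToRoot_eq (.cons h.symm _) (hd.cons hv)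
    refine ⟨?_, ?_⟩
    · rintro rfl
      exact hv (SimpleGraph.Walk.end_mem_support _)
    · rw [parent, heq]
      simp
  · left
    have heq := T.pathToRoot_eq (.cons h _) ((T.pathToRoot_isPath v).cons hu)
    refine ⟨?_, ?_⟩
    · rintro rfl
      exact hu (SimpleGraph.Walk.end_mem_support _)
    · rw [parent, heq]
      simp

theorem IsChild.depth_eq {p c : Fin n} (h : T.IsChild p c) : T.depth p + 1 = T.depth c := by
  rw [← h.2]
  exact depth_parent h.1

variable (T) in
/-- The edge between a vertex and its parent. -/
noncomputable def upEdge (v : Fin n) : Sym2 (Fin n) := s(v, T.parent v)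

theorem upEdge_mem {v : Fin n} (hv : v ≠ T.root) : T.upEdge v ∈ T.graph.edgeSet :=
  adj_parent hv

theorem exists_upEdge_eq {e : Sym2 (Fin n)} (he : e ∈ T.graph.edgeSet) :
    ∃ v, v ≠ T.root ∧ T.upEdge v = e := by
  induction e with
  | _ u v =>
    rcases parent_of_adj (T := T) he with ⟨h, h'⟩ | ⟨h, h'⟩
    · exact ⟨u, h, congrArg (s(u, ·)) h'⟩
    · exact ⟨v, h, (congrArg (s(v, ·)) h').trans Sym2.eq_swap⟩

theorem upEdge_injOn : Set.InjOn T.upEdge {v | v ≠ T.root} := by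
  intro u hu v hv h
  rw [upEdge, upEdge, Sym2.eq_iff] at h
  rcases h with h | ⟨h1, h2⟩
  · exact h.1
  · have hu := depth_parent hu
    have hv := depth_parent hv
    rw [h2] at hu
    rw [← h1] at hv
    omega

-- `P`- and `N`-positions.

theorem isN_iff {v : Fin n} :
    T.IsN v ↔ ∃ a b, T.IsChild v a ∧ T.IsChild v b ∧ a ≠ b ∧ T.IsP a ∧ T.IsP b :=
  ⟨fun h => by cases h with | intro h1 h2 h3 h4 h5 => exact ⟨_, _, h1, h2, h3, h4, h5⟩,
    fun ⟨_, _, h1, h2, h3, h4, h5⟩ => .intro h1 h2 h3 h4 h5⟩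

theorem isP_iff {v : Fin n} :
    T.IsP v ↔ ∀ a b, T.IsChild v a → T.IsChild v b → a ≠ b → T.IsN a ∨ T.IsN b := by
  classical
  constructor
  · rintro ⟨sel, hsel, h⟩ a b ha hb hab
    have := h a b ha hb hab
    rcases hsel a b with h' | h' <;> rw [h'] at this
    · exact .inl this
    · exact .inr this
  · intro h
    refine .intro (fun a b => if T.IsN a then a else b) (fun a b => ?_) fun a b ha hb hab => ?_
    · split_ifs <;> simp
    · split_ifs with hN
      · exact hN
      · exact (h a b ha hb hab).resolve_left hN

theorem isN_iff_not_isP (v : Fin n) : T.IsN v ↔ ¬ T.IsP v := by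
  -- Induction from the deepest vertices towards the root.
  induction hm : n - T.depth v using Nat.strong_induction_on generalizing v with
  | _ m ih =>
    have hc : ∀ a, T.IsChild v a → (T.IsN a ↔ ¬ T.IsP a) := fun a ha => by
      have h1 := ha.depth_eq
      have h2 := T.depth_lt a
      exact ih _ (by omega) a rfl
    rw [isN_iff, isP_iff]
    push Not
    refine exists_congr fun a => exists_congr fun b => ?_
    constructor
    · rintro ⟨h1, h2, h3, h4, h5⟩
      exact ⟨h1, h2, h3, fun h => (hc a h1).1 h h4, fun h => (hc b h2).1 h h5⟩
    · rintro ⟨h1, h2, h3, h4, h5⟩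
      rw [hc a h1, not_not] at h4
      rw [hc b h2, not_not] at h5
      exact ⟨h1, h2, h3, h4, h5⟩

open Classical in
variable (T) in
/-- The children of a vertex that are `P`-positions. -/
noncomputable def pChildren (v : Fin n) : Finset (Fin n) :=
  Finset.univ.filter fun c => T.IsChild v c ∧ T.IsP c

theorem mem_pChildren {v c : Fin n} : c ∈ T.pChildren v ↔ T.IsChild v c ∧ T.IsP c := by
  simp [pChildren]

theorem not_isP_iff_two_le_card {v : Fin n} : ¬ T.IsP v ↔ 2 ≤ (T.pChildren v).card := by
  rw [← isN_iff_not_isP, isN_iff, ← Nat.lt_iff_add_one_le, Finset.one_lt_card]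
  simp only [mem_pChildren]
  constructor
  · rintro ⟨a, b, h1, h2, h3, h4, h5⟩
    exact ⟨a, ⟨h1, h4⟩, b, ⟨h2, h5⟩, h3⟩
  · rintro ⟨a, ⟨h1, h4⟩, b, ⟨h2, h5⟩, h3⟩
    exact ⟨a, b, h1, h2, h3, h4, h5⟩

variable (T) in
/-- The maximum size of a path-collection, counted by upper end vertices of edges. -/
noncomputable def maxEdges : ℕ := ∑ v, min 2 (T.pChildren v).card

end LabelledRootedTree

-- Maximum path-collections.

namespace LabelledRootedTree

variable {n : ℕ} {T : LabelledRootedTree n}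

theorem isChild_iff {p c : Fin n} : T.IsChild p c ↔ c ≠ T.root ∧ T.parent c = p := Iff.rfl

theorem card_pChildren_le_one {v : Fin n} (hv : T.IsP v) : (T.pChildren v).card ≤ 1 := by
  by_contra! h
  exact not_isP_iff_two_le_card.2 h hv

theorem IsPathCollection.card_le {S : Finset (Sym2 (Fin n))} (hS : T.IsPathCollection S) :
    S.card ≤ T.maxEdges := by
  classical
  -- The set indexed by `v` contains the edges charged to `v`.
  have hsub : S ⊆ Finset.univ.biUnion fun v =>
      if T.IsP v then (T.pChildren v).image T.upEdge else S.filter fun e => v ∈ e := by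
    intro e he
    obtain ⟨c, hc, rfl⟩ := exists_upEdge_eq (hS.1 e he)
    simp only [Finset.mem_biUnion, Finset.mem_univ, true_and]
    by_cases h1 : T.IsP (T.parent c)
    · by_cases h2 : T.IsP c
      · refine ⟨T.parent c, ?_⟩
        rw [if_pos h1]
        exact Finset.mem_image_of_mem _ (mem_pChildren.2 ⟨⟨hc, rfl⟩, h2⟩)
      · refine ⟨c, ?_⟩
        rw [if_neg h2]
        simpa [upEdge] using he
    · refine ⟨T.parent c, ?_⟩
      rw [if_neg h1]
      simpa [upEdge] using he
  refine (Finset.card_le_card hsub).trans (Finset.card_biUnion_le.trans ?_)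
  refine Finset.sum_le_sum fun v _ => ?_
  split_ifs with hv
  · have := card_pChildren_le_one hv
    exact Finset.card_image_le.trans (by omega)
  · have := not_isP_iff_two_le_card.1 hv
    exact (hS.2 v).trans (by omega)

variable (T) in
theorem exists_isPathCollection_card_eq :
    ∃ S : Finset (Sym2 (Fin n)), T.IsPathCollection S ∧ S.card = T.maxEdges := by
  classical
  have h : ∀ v, ∃ Y ⊆ T.pChildren v, Y.card = min 2 (T.pChildren v).card := fun v =>
    Finset.exists_subset_card_eq (min_le_right _ _)
  choose Y hY hYcard using h
  have hYm : ∀ {v c}, c ∈ Y v → (c ≠ T.root ∧ T.parent c = v) ∧ T.IsP c := fun hc =>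
    mem_pChildren.1 (hY _ hc)
  refine ⟨(Finset.univ.biUnion Y).image T.upEdge, ⟨?_, fun v => ?_⟩, ?_⟩
  · intro e he
    simp only [Finset.mem_image, Finset.mem_biUnion, Finset.mem_univ, true_and] at he
    obtain ⟨c, ⟨v, hc⟩, rfl⟩ := he
    exact upEdge_mem (hYm hc).1.1
  · have hsub : (((Finset.univ.biUnion Y).image T.upEdge).filter fun e => v ∈ e) ⊆
        (Y v ∪ if T.IsP v then {v} else ∅).image T.upEdge := by
      intro e he
      simp only [Finset.mem_filter, Finset.mem_image, Finset.mem_biUnion, Finset.mem_univ,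
        true_and] at he
      obtain ⟨⟨c, ⟨w, hc⟩, rfl⟩, hv⟩ := he
      refine Finset.mem_image_of_mem _ (Finset.mem_union.2 ?_)
      rw [upEdge, Sym2.mem_iff, (hYm hc).1.2] at hv
      rcases hv with rfl | rfl
      · right
        simp [(hYm hc).2]
      · exact .inl hc
    refine (Finset.card_le_card hsub).trans (Finset.card_image_le.trans
      ((Finset.card_union_le _ _).trans ?_))
    have := hYcard v
    split_ifs with hv
    · have := card_pChildren_le_one hv
      rw [Finset.card_singleton]
      omega
    · rw [Finset.card_empty]
      omega
  · rw [Finset.card_image_of_injOn, Finset.card_biUnion]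
    · exact Finset.sum_congr rfl fun v _ => hYcard v
    · intro v _ w _ hvw
      rw [Function.onFun, Finset.disjoint_left]
      intro c hv hw
      exact hvw ((hYm hv).1.2.symm.trans (hYm hw).1.2)
    · refine upEdge_injOn.mono fun c hc => ?_
      simp only [Finset.coe_biUnion, Set.mem_iUnion] at hc
      obtain ⟨v, -, hc⟩ := hc
      exact (hYm hc).1.1

-- Path covers versus path-collections.

/-- The edges of the paths of a path cover form a path-collection. -/
theorem IsPathCover.exists_isPathCollection {C : Finpartition (Finset.univ : Finset (Fin n))}
    (hC : T.IsPathCover C) :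
    ∃ S : Finset (Sym2 (Fin n)), T.IsPathCollection S ∧ S.card + C.parts.card = n := by
  classical
  have h : ∀ B : Finset (Fin n), ∃ L : List (Sym2 (Fin n)), B ∈ C.parts →
      L.Nodup ∧ L.length + 1 = B.card ∧ (∀ e ∈ L, e ∈ T.graph.edgeSet) ∧
      (∀ e ∈ L, ∀ v ∈ e, v ∈ B) ∧ ∀ v, L.countP (fun e => v ∈ e) ≤ 2 := by
    intro B
    by_cases hB : B ∈ C.parts
    · obtain ⟨u, v, p, hp, rfl⟩ := hC B hB
      refine ⟨p.edges, fun _ => ⟨hp.isTrail.edges_nodup, ?_, fun e he =>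
        p.edges_subset_edgeSet he, fun e he v hv => ?_, hp.countP_mem_edges_le⟩⟩
      · rw [List.toFinset_card_of_nodup hp.support_nodup]
        simp
      · exact List.mem_toFinset.2 (p.mem_support_of_mem_edges he hv)
    · exact ⟨[], fun h => absurd h hB⟩
  choose L hL using h
  refine ⟨C.parts.biUnion fun B => (L B).toFinset, ⟨fun e he => ?_, fun v => ?_⟩, ?_⟩
  · simp only [Finset.mem_biUnion, List.mem_toFinset] at he
    obtain ⟨B, hB, he⟩ := he
    exact (hL B hB).2.2.1 e he
  · obtain ⟨B, hB, hv⟩ := C.exists_mem (Finset.mem_univ v)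
    have hsub : ((C.parts.biUnion fun B => (L B).toFinset).filter fun e => v ∈ e) ⊆
        ((L B).filter fun e => v ∈ e).toFinset := by
      intro e he
      simp only [Finset.mem_filter, Finset.mem_biUnion, List.mem_toFinset] at he
      obtain ⟨⟨B', hB', he⟩, hve⟩ := he
      obtain rfl := C.disjoint.elim_finset hB hB' v hv ((hL B' hB').2.2.2.1 e he v hve)
      simp [he, hve]
    refine (Finset.card_le_card hsub).trans ((List.toFinset_card_le _).trans ?_)
    rw [← List.countP_eq_length_filter]
    exact (hL B hB).2.2.2.2 v
  · rw [Finset.card_biUnion]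
    · have h1 : ∑ B ∈ C.parts, ((L B).toFinset.card + 1) = ∑ B ∈ C.parts, B.card :=
        Finset.sum_congr rfl fun B hB => by
          rw [List.toFinset_card_of_nodup (hL B hB).1, (hL B hB).2.1]
      rw [C.sum_card_parts, Finset.sum_add_distrib] at h1
      simpa using h1
    · intro B hB B' hB' hne
      rw [Function.onFun, Finset.disjoint_left]
      intro e he he'
      rw [List.mem_toFinset] at he he'
      refine hne (C.disjoint.elim_finset hB hB' e.out.1 ?_ ?_)
      · exact (hL B hB).2.2.2.1 e he _ e.out_fst_mem
      · exact (hL B' hB').2.2.2.1 e he' _ e.out_fst_mem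

/-- The components of the graph formed by a path-collection form a path cover. -/
theorem IsPathCollection.exists_isPathCover {S : Finset (Sym2 (Fin n))}
    (hS : T.IsPathCollection S) :
    ∃ C : Finpartition (Finset.univ : Finset (Fin n)),
      T.IsPathCover C ∧ S.card + C.parts.card ≤ n := by
  classical
  let H : SimpleGraph (Fin n) := SimpleGraph.fromEdgeSet (S : Set (Sym2 (Fin n)))
  have hH : ∀ e, e ∈ S ↔ e ∈ H.edgeSet := by
    intro e
    rw [SimpleGraph.edgeSet_fromEdgeSet]
    simp only [Set.mem_sdiff, Finset.mem_coe]
    exact ⟨fun h => ⟨h, T.graph.not_isDiag_of_mem_edgeSet (hS.1 e h)⟩, And.left⟩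
  have hle : H ≤ T.graph := by
    rw [← SimpleGraph.edgeSet_subset_edgeSet]
    exact fun e he => hS.1 e ((hH e).2 he)
  let C := Finpartition.ofSetoid H.reachableSetoid
  have hmem : ∀ {a b}, b ∈ C.part a ↔ H.Reachable a b := fun {a b} =>
    Finpartition.mem_part_ofSetoid_iff_rel
  refine ⟨C, fun B hB => ?_, ?_⟩
  · obtain ⟨a, ha⟩ := C.nonempty_of_mem_parts hB
    obtain ⟨u, v, p, hp, hsupp⟩ :=
      SimpleGraph.exists_isPath_support_eq_of_card_incidence_le_two hH hS.2 a
    refine ⟨u, v, p.mapLe hle, hp.mapLe hle, ?_⟩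
    ext x
    rw [← C.part_eq_of_mem hB ha, hmem, ← hsupp x]
    simp
  · let X : Finset (Fin n) := Finset.univ.filter fun v => v ≠ T.root ∧ T.upEdge v ∈ S
    have hX : S.card ≤ X.card := by
      refine le_trans (Finset.card_le_card ?_) (Finset.card_image_le (f := T.upEdge))
      intro e he
      obtain ⟨v, hv, rfl⟩ := exists_upEdge_eq (hS.1 e he)
      exact Finset.mem_image_of_mem _ (by simp [X, hv, he])
    -- The vertex of least depth in a component is not joined to its parent by an edge of `S`.
    have hC : C.parts.card ≤ Xᶜ.card := by
      refine le_trans (Finset.card_le_card ?_) (Finset.card_image_le (f := C.part))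
      intro B hB
      obtain ⟨v, hvB, hv⟩ := B.exists_min_image T.depth (C.nonempty_of_mem_parts hB)
      have hpart := C.part_eq_of_mem hB hvB
      refine Finset.mem_image.2 ⟨v, ?_, hpart⟩
      rw [Finset.mem_compl]
      intro hvX
      simp only [X, Finset.mem_filter, Finset.mem_univ, true_and] at hvX
      have hadj : H.Adj v (T.parent v) := (hH _).1 hvX.2
      have h1 := hv (T.parent v) (by rw [← hpart, hmem]; exact hadj.reachable)
      have h2 := depth_parent hvX.1
      omega
    have := Finset.card_add_card_compl X
    rw [Fintype.card_fin] at this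
    omega

-- The slither code.

variable (T) in
theorem leafs_nonempty {R : Finset (Fin n)} (h : ∃ v ∈ R, v ≠ T.root) :
    (T.leafs R).Nonempty := by
  classical
  obtain ⟨v, hv, hvr⟩ := h
  obtain ⟨w, hw, hmax⟩ := (R.filter (· ≠ T.root)).exists_max_image T.depth
    ⟨v, Finset.mem_filter.2 ⟨hv, hvr⟩⟩
  rw [Finset.mem_filter] at hw
  refine ⟨w, Finset.mem_filter.2 ⟨hw.1, hw.2, fun c hc hwc => ?_⟩⟩
  have h1 := hmax c (Finset.mem_filter.2 ⟨hc, hwc.1⟩)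
  have h2 := hwc.depth_eq
  omega

variable (T) in
/-- The auxiliary sequence starts with the `P`-positions, and the parent of the last of them is
not a non-root `P`-position. -/
theorem exists_auxFrom_eq_append (R : Finset (Fin n)) :
    ∃ A B : List (Fin n), T.auxFrom R = A ++ B ∧ A.Nodup ∧
      (∀ v, v ∈ A ↔ v ∈ R ∧ v ≠ T.root ∧ T.IsP v) ∧
      ∀ a ∈ A.getLast?, T.parent a ∈ R → T.parent a ≠ T.root → ¬ T.IsP (T.parent a) := by
  induction hm : R.card using Nat.strong_induction_on generalizing R with
  | _ m ih =>
    by_cases h : (T.leafs R).Nonempty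
    · have hmem := (T.leafs R).min'_mem h
      have hcard := erase_min_leafs_card_lt T R h
      rw [auxFrom, dif_pos h]
      generalize (T.leafs R).min' h = w at hmem hcard
      obtain ⟨A, B, hAB, hnd, hA, hlast⟩ := ih _ (hm ▸ hcard) (R.erase w) rfl
      simp only [leafs, Finset.mem_filter] at hmem
      obtain ⟨hwR, hwr, hwleaf⟩ := hmem
      have hlast' : ∀ a ∈ A.getLast?, T.parent a ∈ R → T.parent a ≠ T.root →
          ¬ T.IsP (T.parent a) := by
        intro a ha hpR
        have haA := (hA a).1 (List.mem_of_getLast? ha)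
        -- The removed `w` is not the parent of `a`, because `w` was a leaf while `a` was still
        -- present.
        refine hlast a ha (Finset.mem_erase.2 ⟨fun heq => ?_, hpR⟩)
        exact hwleaf a (Finset.mem_of_mem_erase haA.1) ⟨haA.2.1, heq⟩
      by_cases hP : T.IsP w
      · refine ⟨w :: A, B, by simp [hP, hAB], ?_, fun v => ?_, ?_⟩
        · rw [List.nodup_cons, hA]
          simp [hnd]
        · rw [List.mem_cons, hA, Finset.mem_erase]
          by_cases hvw : v = w
          · subst hvw
            simp [hwR, hwr, hP]
          · simp [hvw]
        · intro a ha hpR hpr hpP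
          rcases List.eq_nil_or_concat A with rfl | ⟨A', b, rfl⟩
          · obtain rfl : w = a := by simpa using ha
            have hne : T.parent w ≠ w := (adj_parent hwr).ne'
            -- A non-root `P`-parent of `w` would still have to be removed after `w`, but no
            -- `P`-position is left to remove.
            have := (hA (T.parent w)).2 ⟨Finset.mem_erase.2 ⟨hne, hpR⟩, hpr, hpP⟩
            simp at this
          · refine hlast' a ?_ hpR hpr hpP
            rw [List.getLast?_cons] at ha
            simpa using ha
      · refine ⟨A, B ++ [w], by simp [hP, hAB], hnd, fun v => ?_, hlast'⟩
        rw [hA, Finset.mem_erase]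
        constructor
        · rintro ⟨h1, h2, h3⟩
          exact ⟨h1.2, h2, h3⟩
        · rintro ⟨h1, h2, h3⟩
          exact ⟨⟨fun hvw => hP (hvw ▸ h3), h1⟩, h2, h3⟩
    · refine ⟨[], [], by rw [auxFrom, dif_neg h]; rfl, List.nodup_nil, fun v => ?_, by simp⟩
      constructor
      · simp
      · rintro ⟨h1, h2, -⟩
        exact absurd (T.leafs_nonempty ⟨v, h1, h2⟩) h

theorem count_map_parent {A : List (Fin n)} (hnd : A.Nodup)
    (hA : ∀ v, v ∈ A ↔ v ≠ T.root ∧ T.IsP v) (x : Fin n) :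
    (A.map T.parent).count x = (T.pChildren x).card := by
  classical
  rw [List.count_eq_countP, List.countP_map, List.countP_eq_length_filter,
    ← List.toFinset_card_of_nodup (hnd.filter _)]
  congr 1
  ext c
  simp [mem_pChildren, isChild_iff, hA]
  tauto

variable (T) in
/-- The position `β` exists, and discarding third occurrences before it leaves `T.maxEdges`
symbols. -/
theorem exists_isLeast_length_keepFirstTwo :
    ∃ β : ℕ, IsLeast {b : ℕ | b ≤ n - 1 ∧
        n - 1 - b ≤ (doublets (T.slitherCode.take b)).card} β ∧
      (keepFirstTwo (T.slitherCode.take β)).length = T.maxEdges := by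
  classical
  obtain ⟨A, B, hAB, hnd, hA, hlast⟩ := T.exists_auxFrom_eq_append Finset.univ
  simp only [Finset.mem_univ, true_and, forall_const] at hA hlast
  let Ps : Finset (Fin n) := Finset.univ.filter fun v => T.IsP v
  have htake : ∀ b ≤ A.length, T.slitherCode.take b = (A.map T.parent).take b := by
    intro b hb
    rw [slitherCode, auxSeq, hAB, List.map_append, List.take_append_of_le_length (by simpa using hb)]
  have hcount := count_map_parent hnd hA
  have hdoub : doublets (A.map T.parent) = Psᶜ := by
    ext x
    simp [doublets, Ps, hcount, not_isP_iff_two_le_card]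
  have hAfin : A.toFinset = Ps.erase T.root := by
    ext v
    simp [hA, Ps]
  have hAcard : A.length = (Ps.erase T.root).card := by
    rw [← hAfin, List.toFinset_card_of_nodup hnd]
  have hPs : Ps.card + Psᶜ.card = n := by simp [Finset.card_add_card_compl]
  have hle1 : A.length ≤ n - 1 := by
    rw [hAcard]
    refine (Finset.card_le_card (Finset.erase_subset_erase T.root Ps.subset_univ)).trans ?_
    simp
  have hle2 : A.length ≤ Ps.card := hAcard ▸ Finset.card_erase_le
  -- The difference is one exactly when the root is a `P`-position.
  have hle3 : Ps.card ≤ A.length + 1 := by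
    have := Finset.pred_card_le_card_erase (s := Ps) (a := T.root)
    omega
  have hfull : (A.map T.parent).take A.length = A.map T.parent :=
    List.take_of_length_le (by simp)
  have hex : ∃ b, b ≤ n - 1 ∧ n - 1 - b ≤ (doublets (T.slitherCode.take b)).card := by
    refine ⟨A.length, hle1, ?_⟩
    rw [htake _ le_rfl, hfull, hdoub]
    omega
  have hsum : (keepFirstTwo (A.map T.parent)).length = T.maxEdges := by
    rw [length_keepFirstTwo, maxEdges]
    exact Finset.sum_congr rfl fun x _ => by rw [hcount]
  refine ⟨Nat.find hex, ⟨Nat.find_spec hex, fun b hb => Nat.find_min' hex hb⟩, ?_⟩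
  have hβ := Nat.find_spec hex
  have hβA : Nat.find hex ≤ A.length := Nat.find_min' hex ⟨hle1, by
    rw [htake _ le_rfl, hfull, hdoub]
    omega⟩
  generalize Nat.find hex = β at hβ hβA
  rw [htake β hβA] at hβ ⊢
  rcases hβA.eq_or_lt with rfl | hlt
  · rw [hfull, hsum]
  have hsub : doublets ((A.map T.parent).take β) ⊆ Psᶜ := by
    rw [← hdoub]
    intro x hx
    simp only [doublets, Finset.mem_filter, Finset.mem_univ, true_and] at hx ⊢
    exact hx.trans ((List.take_sublist _ _).count_le x)
  have hcard := Finset.card_le_card hsub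
  rcases List.eq_nil_or_concat A with rfl | ⟨A', a, rfl⟩
  · simp at hlt
  rw [List.concat_eq_append] at *
  have hlen : (A' ++ [a]).length = A'.length + 1 := by simp
  -- At most `Psᶜ.card` doublets are available, so `β` is at least `Ps.card - 1`, which leaves room
  -- for only one missing symbol.
  obtain rfl : β = A'.length := by omega
  have hcut : ((A' ++ [a]).map T.parent).take A'.length = A'.map T.parent := by
    rw [List.map_append, List.take_append_of_le_length (by simp), List.take_of_length_le (by simp)]
  rw [hcut] at hβ hcard hsub ⊢
  have heq : doublets (A'.map T.parent) = Psᶜ := Finset.eq_of_subset_of_card_le hsub (by omega)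
  -- With a `P`-root the block would have `Ps.card - 1` symbols, and `β` could not be shorter.
  have hroot : T.root ∉ Ps := by
    intro hr
    have := Finset.card_erase_of_mem hr
    omega
  -- The parent of the last `P`-position removed is an `N`-position, so it already occurs twice and
  -- the last symbol adds nothing to the capped count.
  have hparent : T.parent a ∈ doublets (A'.map T.parent) := by
    rw [heq, Finset.mem_compl]
    by_cases hr : T.parent a = T.root
    · rwa [hr]
    · simpa [Ps] using hlast a (by simp) hr
  simp only [doublets, Finset.mem_filter, Finset.mem_univ, true_and] at hparent
  rw [← hsum, length_keepFirstTwo, length_keepFirstTwo]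
  refine Finset.sum_congr rfl fun x _ => ?_
  rw [List.map_append, List.count_append]
  by_cases hx : x = T.parent a
  · subst hx
    omega
  · simp [Ne.symm hx]

end LabelledRootedTree

theorem propositionP (n : ℕ) (T : LabelledRootedTree n) :
    ∃ β : ℕ,
      IsLeast {b : ℕ | b ≤ n - 1 ∧ n - 1 - b ≤ (doublets (T.slitherCode.take b)).card} β ∧
      IsGreatest {k : ℕ | ∃ S : Finset (Sym2 (Fin n)), T.IsPathCollection S ∧ S.card = k}
        (keepFirstTwo (T.slitherCode.take β)).length ∧
      IsLeast {k : ℕ | ∃ C : Finpartition (Finset.univ : Finset (Fin n)),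
          T.IsPathCover C ∧ C.parts.card = k}
        (n - (keepFirstTwo (T.slitherCode.take β)).length) := by
  obtain ⟨β, hβ, hk⟩ := T.exists_isLeast_length_keepFirstTwo
  refine ⟨β, hβ, ?_⟩
  rw [hk]
  have hcover : ∀ C, T.IsPathCover C → n ≤ T.maxEdges + C.parts.card := by
    intro C hC
    obtain ⟨S, hS, hcard⟩ := hC.exists_isPathCollection
    have := hS.card_le
    omega
  obtain ⟨S, hS, hcard⟩ := T.exists_isPathCollection_card_eq
  obtain ⟨C, hC, hCcard⟩ := hS.exists_isPathCover
  refine ⟨⟨⟨S, hS, hcard⟩, ?_⟩, ⟨C, hC, ?_⟩, ?_⟩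
  · rintro k ⟨S', hS', rfl⟩
    exact hS'.card_le
  · have := hcover C hC
    omega
  · rintro k ⟨C', hC', rfl⟩
    have := hcover C' hC'
    omega
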